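/- Let $m,n\in\mathbb{N}$. An MI-LCQP-graph with $m$ constraints and $n$ variables encodes a problem $$\min_{x\in\mathbb{R}^n}\ \tfrac12 x^\top Qx+c^\top x\quad\text{s.t.}\quad Ax\circ b,\ \ l\le x\le u,\ \ x_j\in\mathbb{Z}\ (j\in I),$$ with $A\in\mathbb{R}^{m\times n}$, $Q\in\mathbb{R}^{n\times n}$ symmetric positive semidefinite, $b\in\mathbb{R}^m$, $c\in\mathbb{R}^n$, $\circ\in\{\le,=,\ge\}^m$, $l\in(\mathbb{R}\cup\{-\infty\})^n$, $u\in(\mathbb{R}\cup\{+\infty\})^n$, $I\subset\{1,\dots,n\}$. Its constraint nodes $i\in V=\{1,\dots,m\}$ carry the features $v_i=(b_i,\circ_i)$, its variable nodes $j\in W=\{1,\dots,n\}$ the features $w_j=(c_j,l_j,u_j,\delta_I(j))$, where $\delta_I$ is the indicator of $I$; nodes $i\in V$, $j\in W$ are joined by an edge of weight $A_{ij}$ if $A_{ij}\ne0$, and $j,j'\in W$ (possibly equal) by an edge of weight $Q_{jj'}$ if $Q_{jj'}\neq 0$. Put $\mathcal N_i^W=\{j:A_{ij}\ne0\}$, $\mathcal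 N_j^V=\{i:A_{ij}\ne0\}$, $\mathcal N_j^W=\{j':Q_{jj'}\ne0\}$. The set $\mathcal{G}^{m,n}$ of these graphs has the subspace topology of the product of all data, where $\mathbb{R}\cup\{-\infty\}$ and $\mathbb{R}\cup\{+\infty\}$ are topological disjoint unions and $\{\le,=,\ge\}$ and $\{0,1\}$ (for $\delta_I(j)$) are discrete. Let $\Phi_{\rm feas}(G)=1$ if the problem of $G$ has a feasible point, and $\Phi_{\rm feas}(G)=0$ otherwise. The (collision-free) Weisfeiler–Lehman test assigns the colors $C_i^{0,V}=v_i$, $C_j^{0,W}=w_j$ and, for $k\ge1$, $$C_i^{k,V}=\big(C_i^{k-1,V},\{\{(C_j^{k-1,W},A_{ij}):j\in\mathcal N_i^W\}\}\big),$$ $$C_j^{k,W}=\big(C_j^{k-1,W},\{\{(C_i^{k-1,V},A_{ij}):i\in\mathcal N_j^V\}\},\{\{(C_{j'}^{k-1,W},Q_{jj'}):j'\in\mathcal N_j^W\}\}\big),$$ where $\{\{\cdot\}\}$ denotes multisets. Two nodes of $V$ (or of $W$) are in the same class of the final stable partition if their colors agree for all $k$. The graph is message-passing-tractable if $A_{ij}$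 is constant over $i\in I'$, $j\in J$ for all classes $I'\subset V$, $J\subset W$, and $Q_{jj'}$ is constant over $j\in J$, $j'\in J'$ for all classes $J,J'\subset W$. A GNN $F$ consists of a number $L\geq 0$ of layers and of continuous maps $f_k^V,f_k^W$ $(0\le k\le L)$, $g_k^V,g_k^W,g_k^Q$ $(1\le k\le L)$, $r$ between spaces as below, with real finite-dimensional hidden spaces of arbitrary dimensions. It computes $s_i^0=f_0^V(v_i)$, $t_j^0=f_0^W(w_j)$ and, for $1\le k\le L$, $$s_i^k=f_k^V\Big(s_i^{k-1},\sum_{j\in\mathcal N_i^W}g_k^W(t_j^{k-1},A_{ij})\Big),$$ $$t_j^k=f_k^W\Big(t_j^{k-1},\sum_{i\in\mathcal N_j^V}g_k^V(s_i^{k-1},A_{ij}),\sum_{j'\in\mathcal N_j^W}g_k^Q(t_{j'}^{k-1},Q_{jj'})\Big),$$ and outputs $F(G)=r\big(\sum_{i\in V}s_i^L,\sum_{j\in W}t_j^L\big)\in\mathbb{R}$. **Theorem.** Let $\mathbb{P}$ be a regular Borel probability measure on $\mathcal{G}^{m,n}$ such that $\mathbb{P}[G\text{ is message-passing-tractable}]=1$.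 Then for every $\epsilon>0$ there is a GNN $F$ with $$\mathbb{P}\big[\mathbb{I}_{F(G)>\frac12}\ne\Phi_{\rm feas}(G)\big]<\epsilon.$$ -/

import Mathlib

open MeasureTheory

/-- The type of a linear constraint: `≤`, `=` or `≥`. -/
inductive ConstraintSense : Type
  | le
  | eq
  | ge

/-- The three-point set `{≤, =, ≥}` is discrete. -/
instance ConstraintSense.instTopologicalSpace : TopologicalSpace ConstraintSense := ⊥

instance ConstraintSense.instDiscreteTopology : DiscreteTopology ConstraintSense := ⟨rfl⟩

/-- `σ.Holds y β` is the relation `y ∘ β` for `∘` the relation named by `σ`. -/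
def ConstraintSense.Holds : ConstraintSense → ℝ → ℝ → Prop
  | .le, y, β => y ≤ β
  | .eq, y, β => y = β
  | .ge, y, β => β ≤ y

/-- `ℝ ∪ {-∞}` as a topological disjoint union; the point `Sum.inr ()` is `-∞`. -/
abbrev LowerBound : Type := ℝ ⊕ Unit

/-- `ℝ ∪ {+∞}` as a topological disjoint union; the point `Sum.inr ()` is `+∞`. -/
abbrev UpperBound : Type := ℝ ⊕ Unit

/-- `lo ≤ x` for `lo ∈ ℝ ∪ {-∞}`. -/
def LowerBound.Holds (lo : LowerBound) (x : ℝ) : Prop :=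
  Sum.elim (fun a : ℝ => a ≤ x) (fun _ => True) lo

/-- `x ≤ up` for `up ∈ ℝ ∪ {+∞}`. -/
def UpperBound.Holds (up : UpperBound) (x : ℝ) : Prop :=
  Sum.elim (fun a : ℝ => x ≤ a) (fun _ => True) up

/-- The feature `v_i = (b_i, ∘_i)` of a constraint node. -/
abbrev ConstraintFeature : Type := ℝ × ConstraintSense

/-- The feature `w_j = (c_j, l_j, u_j, δ_I(j))` of a variable node. -/
abbrev VariableFeature : Type := ℝ × LowerBound × UpperBound × Bool

/-- MI-LCQP-graphs with `m` constraint nodes and `n` variable nodes, that is, the data of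
`min ½ xᵀ Q x + cᵀ x` subject to `A x ∘ b`, `l ≤ x ≤ u`, and `x_j ∈ ℤ` for `j ∈ I`,
with `Q` symmetric and positive semidefinite. -/
structure MILCQPGraph (m n : ℕ) : Type where
  /-- weights of the edges between constraint nodes and variable nodes -/
  A : Matrix (Fin m) (Fin n) ℝ
  /-- weights of the edges between variable nodes -/
  Q : Matrix (Fin n) (Fin n) ℝ
  /-- right-hand sides of the constraints -/
  b : Fin m → ℝ
  /-- senses of the constraints -/
  sense : Fin m → ConstraintSense
  /-- linear part of the objective -/
  c : Fin n → ℝ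
  /-- lower bounds of the variables -/
  l : Fin n → LowerBound
  /-- upper bounds of the variables -/
  u : Fin n → UpperBound
  /-- indicator `δ_I` of the set of integer variables -/
  isInt : Fin n → Bool
  /-- `Q` is symmetric and positive semidefinite -/
  posSemidef : Q.PosSemidef

namespace MILCQPGraph

variable {m n : ℕ}

/-- The data of a graph as a point of a product space. -/
def toProd (G : MILCQPGraph m n) :
    Matrix (Fin m) (Fin n) ℝ × Matrix (Fin n) (Fin n) ℝ × (Fin m → ℝ) ×
      (Fin m → ConstraintSense) × (Fin n → ℝ) × (Fin n → LowerBound) ×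
      (Fin n → UpperBound) × (Fin n → Bool) :=
  (G.A, G.Q, G.b, G.sense, G.c, G.l, G.u, G.isInt)

/-- The subspace topology coming from the product of all data. -/
instance instTopologicalSpace : TopologicalSpace (MILCQPGraph m n) :=
  TopologicalSpace.induced toProd inferInstance

/-- The Borel σ-algebra. -/
instance instMeasurableSpace : MeasurableSpace (MILCQPGraph m n) :=
  borel (MILCQPGraph m n)

instance instBorelSpace : BorelSpace (MILCQPGraph m n) := ⟨rfl⟩

/-- Feature of the constraint node `i`. -/
def vFeature (G : MILCQPGraph m n) (i : Fin m) : ConstraintFeature :=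
  (G.b i, G.sense i)

/-- Feature of the variable node `j`. -/
def wFeature (G : MILCQPGraph m n) (j : Fin n) : VariableFeature :=
  (G.c j, G.l j, G.u j, G.isInt j)

/-- The variable nodes adjacent to the constraint node `i`. -/
noncomputable def nbrVW (G : MILCQPGraph m n) (i : Fin m) : Finset (Fin n) :=
  Finset.univ.filter fun j => G.A i j ≠ 0

/-- The constraint nodes adjacent to the variable node `j`. -/
noncomputable def nbrWV (G : MILCQPGraph m n) (j : Fin n) : Finset (Fin m) :=
  Finset.univ.filter fun i => G.A i j ≠ 0

/-- The variable nodes adjacent to the variable node `j` (self-loops are permitted). -/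
noncomputable def nbrWW (G : MILCQPGraph m n) (j : Fin n) : Finset (Fin n) :=
  Finset.univ.filter fun j' => G.Q j j' ≠ 0

/-- `x` satisfies all the constraints of the MI-LCQP problem. -/
def IsFeasible (G : MILCQPGraph m n) (x : Fin n → ℝ) : Prop :=
  (∀ i, (G.sense i).Holds (G.A.mulVec x i) (G.b i)) ∧
  (∀ j, LowerBound.Holds (G.l j) (x j)) ∧
  (∀ j, UpperBound.Holds (G.u j) (x j)) ∧
  (∀ j, G.isInt j = true → ∃ z : ℤ, x j = z)

open Classical in
/-- The feasibility mapping `Φ_feas`. -/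
noncomputable def feas (G : MILCQPGraph m n) : ℝ :=
  if ∃ x : Fin n → ℝ, G.IsFeasible x then 1 else 0

end MILCQPGraph

/-- The colors of the WL test after `l` iterations, first for constraint nodes and second for
variable nodes.  A color is the very tuple that would be hashed, so that no two different
tuples ever collide. -/
def WLColor : ℕ → Type × Type
  | 0 => (ConstraintFeature, VariableFeature)
  | l + 1 =>
    ((WLColor l).1 × Multiset ((WLColor l).2 × ℝ),
      (WLColor l).2 × Multiset ((WLColor l).1 × ℝ) × Multiset ((WLColor l).2 × ℝ))

namespace MILCQPGraph

variable {m n : ℕ}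

/-- The colors of all nodes after `l` iterations of the (collision-free) WL test. -/
noncomputable def wlColor (G : MILCQPGraph m n) :
    (l : ℕ) → (Fin m → (WLColor l).1) × (Fin n → (WLColor l).2)
  | 0 => (G.vFeature, G.wFeature)
  | l + 1 =>
    (fun i => ((G.wlColor l).1 i,
        (G.nbrVW i).val.map fun j => ((G.wlColor l).2 j, G.A i j)),
      fun j => ((G.wlColor l).2 j,
        (G.nbrWV j).val.map fun i => ((G.wlColor l).1 i, G.A i j),
        (G.nbrWW j).val.map fun j' => ((G.wlColor l).2 j', G.Q j j')))

/-- Two constraint nodes lie in the same class of the final stable partition: each iteration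
refines the partition of the previous one, so this means equal colors at every iteration. -/
def SameClassV (G : MILCQPGraph m n) (i i' : Fin m) : Prop :=
  ∀ l, (G.wlColor l).1 i = (G.wlColor l).1 i'

/-- Two variable nodes lie in the same class of the final stable partition. -/
def SameClassW (G : MILCQPGraph m n) (j j' : Fin n) : Prop :=
  ∀ l, (G.wlColor l).2 j = (G.wlColor l).2 j'

/-- Message-passing-tractability: `A` is constant on each block `I_p × J_q`, and `Q` is constant
on each block `J_q × J_q'`, of the final stable partition of the WL test. -/
def MPTractable (G : MILCQPGraph m n) : Prop :=
  (∀ i i' j j', G.SameClassV i i' → G.SameClassW j j' → G.A i j = G.A i' j') ∧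
  (∀ j₁ j₁' j₂ j₂', G.SameClassW j₁ j₁' → G.SameClassW j₂ j₂' → G.Q j₁ j₂ = G.Q j₁' j₂')

end MILCQPGraph

/-- Message-passing graph neural networks for MI-LCQP-graphs with graph-level output.
The maps do not depend on the size of the input graph.  The maps with index `l` compute the
layer `l + 1` from the layer `l`; only those with `l < depth` are used. -/
structure MILCQPGNN : Type where
  /-- the number `L` of message-passing layers -/
  depth : ℕ
  /-- dimensions of the constraint node features -/
  dV : ℕ → ℕ
  /-- dimensions of the variable node features -/
  dW : ℕ → ℕ
  /-- dimensions of the messages sent by constraint nodes -/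
  eV : ℕ → ℕ
  /-- dimensions of the messages sent by variable nodes to constraint nodes -/
  eW : ℕ → ℕ
  /-- dimensions of the messages sent by variable nodes to variable nodes -/
  eQ : ℕ → ℕ
  f0V : ConstraintFeature → (Fin (dV 0) → ℝ)
  f0W : VariableFeature → (Fin (dW 0) → ℝ)
  gV : (l : ℕ) → (Fin (dV l) → ℝ) × ℝ → (Fin (eV l) → ℝ)
  gW : (l : ℕ) → (Fin (dW l) → ℝ) × ℝ → (Fin (eW l) → ℝ)
  gQ : (l : ℕ) → (Fin (dW l) → ℝ) × ℝ → (Fin (eQ l) → ℝ)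
  fV : (l : ℕ) → (Fin (dV l) → ℝ) × (Fin (eW l) → ℝ) → (Fin (dV (l + 1)) → ℝ)
  fW : (l : ℕ) → (Fin (dW l) → ℝ) × (Fin (eV l) → ℝ) × (Fin (eQ l) → ℝ) →
    (Fin (dW (l + 1)) → ℝ)
  r : (Fin (dV depth) → ℝ) × (Fin (dW depth) → ℝ) → ℝ
  continuous_f0V : Continuous f0V
  continuous_f0W : Continuous f0W
  continuous_gV : ∀ l, Continuous (gV l)
  continuous_gW : ∀ l, Continuous (gW l)
  continuous_gQ : ∀ l, Continuous (gQ l)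
  continuous_fV : ∀ l, Continuous (fV l)
  continuous_fW : ∀ l, Continuous (fW l)
  continuous_r : Continuous r

namespace MILCQPGNN

variable {m n : ℕ}

/-- The node features `(s_i^l)_i` and `(t_j^l)_j` after `l` layers on the input graph `G`. -/
noncomputable def features (F : MILCQPGNN) (G : MILCQPGraph m n) :
    (l : ℕ) → (Fin m → Fin (F.dV l) → ℝ) × (Fin n → Fin (F.dW l) → ℝ)
  | 0 => (fun i => F.f0V (G.vFeature i), fun j => F.f0W (G.wFeature j))
  | l + 1 =>
    (fun i => F.fV l ((F.features G l).1 i,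
        ∑ j ∈ G.nbrVW i, F.gW l ((F.features G l).2 j, G.A i j)),
      fun j => F.fW l ((F.features G l).2 j,
        ∑ i ∈ G.nbrWV j, F.gV l ((F.features G l).1 i, G.A i j),
        ∑ j' ∈ G.nbrWW j, F.gQ l ((F.features G l).2 j', G.Q j j')))

/-- The graph-level output of the network on the input graph `G`. -/
noncomputable def eval (F : MILCQPGNN) (G : MILCQPGraph m n) : ℝ :=
  F.r (∑ i, (F.features G F.depth).1 i, ∑ j, (F.features G F.depth).2 j)

/-- The classifier `𝕀_{F(G) > 1/2}`. -/
noncomputable def classify (F : MILCQPGNN) (G : MILCQPGraph m n) : ℝ :=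
  if F.eval G > 1 / 2 then 1 else 0

end MILCQPGNN

/-! On tractable graphs the WL colors determine the matrix `A` up to a relabelling of the nodes, so
they determine feasibility; and a single continuous network can reproduce the WL test exactly,
without approximation.

The second point rests on `exists_continuous_sum_separating`: sums of monomials, each multiplied by
the edge weight, determine a multiset of at most `N` points with nonzero weights. The factor makes
messages vanish at weight zero, so a sum over neighbors equals a sum over all nodes and stays
continuous in `G` when edges appear or vanish. Iterating this encoding gives `sepGNN`, whose
features agree exactly when the colors do (`sepFeatures_eq_iff`), across any two graphs of the given
size.

For the first point, the test is stable after `wlBound m n` rounds. One more round shows which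
weights join a node to each class, and tractability leaves only one weight per block. Graphs with
matching colors thus have matching entries of `A` and matching node features
(`exists_isFeasible_of_wlColor_eq`).

Inner regularity then supplies compact sets of feasible and of infeasible tractable graphs that
carry all but `ε` of the mass. Their images under the continuous map `sepSum` are compact and
disjoint, and a Urysohn function on the feature space serves as readout. -/

/-! ### Separating multisets by sums of monomials. -/

/-- Weighted sums of the monomials with exponents at most `D` determine the weighted sums of
all polynomials of total degree at most `D`. -/
theorem MvPolynomial.weighted_sum_eval_eq {κ ι : Type*} [Fintype κ] [Fintype ι]
    (D : ℕ) (a a' : ι → ℝ) (x x' : ι → κ → ℝ)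
    (h : ∀ α : κ → Fin (D + 1),
      ∑ j, a j * ∏ k, x j k ^ (α k : ℕ) = ∑ j, a' j * ∏ k, x' j k ^ (α k : ℕ))
    (q : MvPolynomial κ ℝ) (hq : q.totalDegree ≤ D) :
    ∑ j, a j * MvPolynomial.eval (x j) q = ∑ j, a' j * MvPolynomial.eval (x' j) q := by
  simp only [MvPolynomial.eval_eq', Finset.mul_sum]
  rw [Finset.sum_comm, Finset.sum_comm (s := Finset.univ) (t := q.support)]
  refine Finset.sum_congr rfl fun s hs => ?_
  have hs' : ∀ k, s k ≤ D := fun k =>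
    ((Finsupp.le_degree k s).trans (MvPolynomial.le_totalDegree hs)).trans hq
  have := h fun k => ⟨s k, Nat.lt_succ_of_le (hs' k)⟩
  simp only at this
  simp only [mul_left_comm (a _), mul_left_comm (a' _), ← Finset.mul_sum, this]

/-- Finitely many weighted monomials separate multisets of at most `N` points with nonzero
weights. -/
theorem exists_continuous_sum_separating (d N : ℕ) :
    ∃ (e : ℕ) (g : (Fin d → ℝ) × ℝ → Fin e → ℝ), Continuous g ∧ (∀ t, g (t, 0) = 0) ∧
      ∀ x x' : Fin N → (Fin d → ℝ) × ℝ, ∑ j, g (x j) = ∑ j, g (x' j) →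
        (Finset.univ.filter fun j => (x j).2 ≠ 0).val.map x =
          (Finset.univ.filter fun j => (x' j).2 ≠ 0).val.map x' := by
  classical
  let κ := Option (Fin d)
  let I := κ → Fin (N + N + 1)
  let c : (Fin d → ℝ) × ℝ → κ → ℝ := fun p o => o.elim p.2 p.1
  have hc : Function.Injective c := fun p p' h =>
    Prod.ext (funext fun k => congrFun h (some k)) (congrFun h none)
  have hcc : ∀ k, Continuous fun p => c p k := by
    rintro (_ | k)
    · exact continuous_snd
    · exact (continuous_apply k).comp continuous_fst
  refine ⟨Fintype.card I,
    fun p i => p.2 * ∏ k, c p k ^ ((Fintype.equivFin I).symm i k : ℕ), ?_, ?_, ?_⟩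
  · exact continuous_pi fun i => continuous_snd.mul
      (continuous_finsetProd _ fun k _ => (hcc k).pow _)
  · intro t
    ext i
    simp
  intro x x' h
  have hq := MvPolynomial.weighted_sum_eval_eq (N + N) (fun j => (x j).2) (fun j => (x' j).2)
    (fun j => c (x j)) (fun j => c (x' j)) (fun α => by
      have := congrFun h (Fintype.equivFin I α)
      simpa [Finset.sum_apply] using this)
  ext y
  rw [Multiset.count_map, Multiset.count_map]
  by_cases hy : y.2 = 0
  · have h0 : ∀ z : Fin N → (Fin d → ℝ) × ℝ, Multiset.filter (fun a => y = z a)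
        (Finset.univ.filter fun j => (z j).2 ≠ 0).val = 0 := by
      intro z
      rw [Multiset.filter_eq_nil]
      rintro j hj rfl
      exact ((Finset.mem_filter.1 (Finset.mem_def.2 hj)).2 hy)
    rw [h0, h0]
  -- To compare the multiplicities of `y`, build a polynomial that vanishes at all other points of
  -- both families but not at `y`. One linear factor for each such point gives degree at most `N +
  -- N`.
  let S := (Finset.univ.image x ∪ Finset.univ.image x').erase y
  have hS : ∀ z, z ≠ y → ∃ k, c z k ≠ c y k := fun z hz => by
    by_contra! H
    exact hz (hc (funext H))
  -- A coordinate in which `z` differs from `y`; the value `none` at `z = y` is never used, since `y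
  -- ∉ S`.
  let k : (Fin d → ℝ) × ℝ → κ := fun z => if hz : z ≠ y then (hS z hz).choose else none
  have hk : ∀ z ∈ S, c y (k z) - c z (k z) ≠ 0 := fun z hz => by
    have hz' := (Finset.mem_erase.1 hz).1
    simp only [k, dif_pos hz']
    exact sub_ne_zero.2 (hS z hz').choose_spec.symm
  let q : MvPolynomial κ ℝ := ∏ z ∈ S, (MvPolynomial.X (k z) - MvPolynomial.C (c z (k z)))
  have hdeg : q.totalDegree ≤ N + N := by
    refine (MvPolynomial.totalDegree_finsetProd _ _).trans ?_
    refine (Finset.sum_le_card_nsmul S _ 1 fun z _ => ?_).trans ?_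
    · refine (MvPolynomial.totalDegree_sub _ _).trans ?_
      simp
    · rw [smul_eq_mul, mul_one]
      refine (Finset.card_erase_le).trans ((Finset.card_union_le _ _).trans ?_)
      exact add_le_add (Finset.card_image_le.trans (by simp)) (Finset.card_image_le.trans (by simp))
  have hev : ∀ p, MvPolynomial.eval (c p) q = ∏ z ∈ S, (c p (k z) - c z (k z)) := fun p => by
    simp [q]
  have hqy : MvPolynomial.eval (c y) q ≠ 0 := by
    rw [hev]
    exact Finset.prod_ne_zero_iff.2 hk
  have hqz : ∀ p ∈ Finset.univ.image x ∪ Finset.univ.image x',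
      p.2 * MvPolynomial.eval (c p) q = if y = p then y.2 * MvPolynomial.eval (c y) q else 0 := by
    intro p hp
    split_ifs with hpy
    · rw [hpy]
    · rw [hev]
      refine mul_eq_zero_of_right _
        (Finset.prod_eq_zero (i := p) (Finset.mem_erase.2 ⟨Ne.symm hpy, hp⟩) ?_)
      exact sub_self _
  have key := hq q hdeg
  rw [Finset.sum_congr rfl fun j _ => hqz (x j) (by simp),
    Finset.sum_congr rfl fun j _ => hqz (x' j) (by simp), ← Finset.sum_filter,
    ← Finset.sum_filter, Finset.sum_const, Finset.sum_const, nsmul_eq_mul, nsmul_eq_mul] at key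
  -- Both sides of `key` are a multiplicity of `y` times the same nonzero number.
  have key' := mul_right_cancel₀ (mul_ne_zero hy hqy) key
  have hcard : ∀ z : Fin N → (Fin d → ℝ) × ℝ, Multiset.card (Multiset.filter (fun a => y = z a)
        (Finset.univ.filter fun j => (z j).2 ≠ 0).val) =
      (Finset.univ.filter fun j => y = z j).card := by
    intro z
    rw [← Finset.filter_val, Finset.card_val, Finset.filter_filter]
    congr 1
    ext j
    simp only [Finset.mem_filter, Finset.mem_univ, true_and]
    exact ⟨fun h => h.2, fun h => ⟨h ▸ hy, h⟩⟩
  rw [hcard, hcard]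
  exact_mod_cast key'

/-- The dimension of the target of `sepMap`. -/
noncomputable def sepDim (d N : ℕ) : ℕ := (exists_continuous_sum_separating d N).choose

/-- A continuous map whose sums over at most `N` points of `ℝᵈ` with nonzero weights separate
multisets. -/
noncomputable def sepMap (d N : ℕ) : (Fin d → ℝ) × ℝ → Fin (sepDim d N) → ℝ :=
  (exists_continuous_sum_separating d N).choose_spec.choose

theorem continuous_sepMap (d N : ℕ) : Continuous (sepMap d N) :=
  (exists_continuous_sum_separating d N).choose_spec.choose_spec.1

theorem sepMap_zero {d N : ℕ} (t : Fin d → ℝ) : sepMap d N (t, 0) = 0 :=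
  (exists_continuous_sum_separating d N).choose_spec.choose_spec.2.1 t

theorem map_eq_of_sum_sepMap_eq {d N : ℕ} {x x' : Fin N → (Fin d → ℝ) × ℝ}
    (h : ∑ j, sepMap d N (x j) = ∑ j, sepMap d N (x' j)) :
    (Finset.univ.filter fun j => (x j).2 ≠ 0).val.map x =
      (Finset.univ.filter fun j => (x' j).2 ≠ 0).val.map x' :=
  (exists_continuous_sum_separating d N).choose_spec.choose_spec.2.2 x x' h

theorem map_eq_of_sum_sepMap_one_eq {d N : ℕ} {x x' : Fin N → Fin d → ℝ}
    (h : ∑ j, sepMap d N (x j, 1) = ∑ j, sepMap d N (x' j, 1)) :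
    (Finset.univ : Finset (Fin N)).val.map x = (Finset.univ : Finset (Fin N)).val.map x' := by
  have := congrArg (Multiset.map Prod.fst)
    (map_eq_of_sum_sepMap_eq (x := fun j => (x j, 1)) (x' := fun j => (x' j, 1)) h)
  simpa [Multiset.map_map, Function.comp_def] using this

/-- Constant families turn separation of multisets into injectivity. The index `i` excludes `N = 0`,
where nothing is separated. -/
theorem sepMap_one_injective {d N : ℕ} (i : Fin N) {x x' : Fin d → ℝ}
    (h : sepMap d N (x, 1) = sepMap d N (x', 1)) : x = x' := by
  have := map_eq_of_sum_sepMap_one_eq (x := fun _ : Fin N => x) (x' := fun _ => x')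
    (by simp only [h])
  have hx : x ∈ (Finset.univ : Finset (Fin N)).val.map fun _ => x :=
    Multiset.mem_map.2 ⟨i, by simp, rfl⟩
  rw [this] at hx
  obtain ⟨_, _, h⟩ := Multiset.mem_map.1 hx
  exact h.symm

/-! ### Multisets of values and permutations. -/

/-- If two families have the same multiset of values and equality of `φ`-values forces equality
of `ψ`-values, then the `ψ`-families have the same multiset of values. -/
theorem Multiset.map_eq_map_of_imp {α α' β γ : Type*} {s : Multiset α} {s' : Multiset α'}
    {φ : α → β} {φ' : α' → β} {ψ : α → γ} {ψ' : α' → γ} (h : s.map φ = s'.map φ')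
    (himp : ∀ x x', φ x = φ' x' → ψ x = ψ' x') : s.map ψ = s'.map ψ' := by
  rw [← Multiset.rel_eq, Multiset.rel_map] at h ⊢
  exact h.mono fun a _ b _ hab => himp a b hab

/-- Two families on a finite type with the same multiset of values differ by a permutation. -/
theorem exists_perm_of_map_univ_eq {ι α : Type*} [Fintype ι] {f f' : ι → α}
    (h : (Finset.univ : Finset ι).val.map f = (Finset.univ : Finset ι).val.map f') :
    ∃ σ : Equiv.Perm ι, ∀ i, f i = f' (σ i) := by
  classical
  -- Fibers over the same value have equal cardinality; bijections between them glue to a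
  -- permutation.
  have hc : ∀ a, Nonempty ({i // f i = a} ≃ {i // f' i = a}) := fun a => by
    refine ⟨Fintype.equivOfCardEq ?_⟩
    have := congrArg (Multiset.count a) h
    rw [Multiset.count_map, Multiset.count_map, ← Finset.filter_val, ← Finset.filter_val,
      Finset.card_val, Finset.card_val] at this
    rw [Fintype.card_subtype, Fintype.card_subtype]
    simpa only [eq_comm] using this
  refine ⟨(Equiv.sigmaFiberEquiv f).symm.trans
    ((Equiv.sigmaCongrRight fun a => (hc a).some).trans (Equiv.sigmaFiberEquiv f')), fun i => ?_⟩
  exact ((hc (f i)).some ⟨i, rfl⟩).2.symm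

/-! ### Continuous injective real coordinates for the node features. -/

theorem continuous_finAppend {p q : ℕ} :
    Continuous fun x : (Fin p → ℝ) × (Fin q → ℝ) => Fin.append x.1 x.2 := by
  refine continuous_pi fun i => ?_
  refine Fin.addCases (fun i => ?_) (fun i => ?_) i
  · simpa using (continuous_apply i).comp' continuous_fst
  · simpa using (continuous_apply i).comp' continuous_snd

theorem Continuous.finAppend {X : Type*} [TopologicalSpace X] {p q : ℕ} {f : X → Fin p → ℝ}
    {g : X → Fin q → ℝ} (hf : Continuous f) (hg : Continuous g) :
    Continuous fun x => Fin.append (f x) (g x) :=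
  continuous_finAppend.comp (hf.prodMk hg)

theorem continuous_sum_sepMap {X : Type*} [TopologicalSpace X] {d N M : ℕ}
    {t : X → Fin M → Fin d → ℝ} {a : X → Fin M → ℝ} (ht : ∀ j, Continuous fun x => t x j)
    (ha : ∀ j, Continuous fun x => a x j) :
    Continuous fun x => ∑ j, sepMap d N (t x j, a x j) :=
  continuous_finsetSum _ fun j _ => (continuous_sepMap d N).comp ((ht j).prodMk (ha j))

theorem finAppend_inj {p q : ℕ} {x x' : Fin p → ℝ} {y y' : Fin q → ℝ} :
    Fin.append x y = Fin.append x' y' ↔ x = x' ∧ y = y' := by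
  refine ⟨fun h => ⟨funext fun i => ?_, funext fun i => ?_⟩, fun h => by rw [h.1, h.2]⟩
  · simpa using congrFun h (Fin.castAdd q i)
  · simpa using congrFun h (Fin.natAdd p i)

/-- A numerical code for the sense of a constraint. -/
def ConstraintSense.code : ConstraintSense → ℝ
  | .le => 0
  | .eq => 1
  | .ge => 2

theorem ConstraintSense.code_injective : Function.Injective ConstraintSense.code := by
  intro a b h
  cases a <;> cases b <;> simp_all [ConstraintSense.code]

/-- The coordinates of the feature of a constraint node. -/
def ConstraintFeature.coord (v : ConstraintFeature) : Fin 2 → ℝ := ![v.1, v.2.code]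

theorem ConstraintFeature.continuous_coord : Continuous ConstraintFeature.coord := by
  refine continuous_pi fun k => ?_
  fin_cases k
  · exact continuous_fst
  · exact (continuous_of_discreteTopology (f := ConstraintSense.code)).comp continuous_snd

theorem ConstraintFeature.coord_injective : Function.Injective ConstraintFeature.coord := by
  intro v v' h
  exact Prod.ext (congrFun h 0) (ConstraintSense.code_injective (congrFun h 1))

/-- The value of an extended real, with infinity replaced by `0`. -/
def boundValue : ℝ ⊕ Unit → ℝ := Sum.elim id fun _ => 0

/-- The indicator of infinity. -/
def boundFlag : ℝ ⊕ Unit → ℝ := Sum.elim (fun _ => 0) fun _ => 1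

theorem continuous_boundValue : Continuous boundValue := continuous_id.sumElim continuous_const

theorem continuous_boundFlag : Continuous boundFlag :=
  continuous_const.sumElim continuous_const

theorem bound_ext {a a' : ℝ ⊕ Unit} (h : boundValue a = boundValue a')
    (h' : boundFlag a = boundFlag a') : a = a' := by
  rcases a with a | a <;> rcases a' with a' | a' <;> simp [boundValue, boundFlag] at h h' ⊢
  exact h

/-- The coordinates of the feature of a variable node. -/
def VariableFeature.coord (w : VariableFeature) : Fin 6 → ℝ :=
  ![w.1, boundValue w.2.1, boundFlag w.2.1, boundValue w.2.2.1, boundFlag w.2.2.1,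
    cond w.2.2.2 1 0]

theorem VariableFeature.continuous_coord : Continuous VariableFeature.coord := by
  have h1 : Continuous fun w : VariableFeature => w.2.1 := by fun_prop
  have h2 : Continuous fun w : VariableFeature => w.2.2.1 := by fun_prop
  have h3 : Continuous fun w : VariableFeature => w.2.2.2 := by fun_prop
  refine continuous_pi fun k => ?_
  fin_cases k
  · exact continuous_fst
  · exact continuous_boundValue.comp h1
  · exact continuous_boundFlag.comp h1
  · exact continuous_boundValue.comp h2
  · exact continuous_boundFlag.comp h2
  · exact (continuous_of_discreteTopology (f := fun b : Bool => cond b (1 : ℝ) 0)).comp h3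

theorem VariableFeature.coord_injective : Function.Injective VariableFeature.coord := by
  intro w w' h
  refine Prod.ext (congrFun h 0) (Prod.ext (bound_ext (congrFun h 1) (congrFun h 2))
    (Prod.ext (bound_ext (congrFun h 3) (congrFun h 4)) ?_))
  have h5 : (cond w.2.2.2 1 0 : ℝ) = cond w'.2.2.2 1 0 := congrFun h 5
  revert h5
  cases w.2.2.2 <;> cases w'.2.2.2 <;> simp

/-! ### The separating network and its agreement with the WL test. -/

/-- The dimensions of the node features of the separating network. -/
noncomputable def sepDims (m n : ℕ) : ℕ → ℕ × ℕ
  | 0 => (sepDim 2 m, sepDim 6 n)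
  | l + 1 =>
    (sepDim ((sepDims m n l).1 + sepDim (sepDims m n l).2 n) m,
      sepDim ((sepDims m n l).2 + (sepDim (sepDims m n l).1 m + sepDim (sepDims m n l).2 n)) n)

/-- A network whose node features separate exactly the colors of the WL test on graphs with `m`
constraint nodes and `n` variable nodes. -/
noncomputable def sepGNN (m n L : ℕ)
    (r : (Fin (sepDims m n L).1 → ℝ) × (Fin (sepDims m n L).2 → ℝ) → ℝ) (hr : Continuous r) :
    MILCQPGNN where
  depth := L
  dV l := (sepDims m n l).1
  dW l := (sepDims m n l).2
  eV l := sepDim (sepDims m n l).1 m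
  eW l := sepDim (sepDims m n l).2 n
  eQ l := sepDim (sepDims m n l).2 n
  f0V v := sepMap 2 m (v.coord, 1)
  f0W w := sepMap 6 n (w.coord, 1)
  gV l := sepMap (sepDims m n l).1 m
  gW l := sepMap (sepDims m n l).2 n
  gQ l := sepMap (sepDims m n l).2 n
  -- The outer `sepMap` with weight 1 ensures that the plain sum of the node features, which the
  -- readout receives, determines their multiset.
  fV _ p := sepMap _ m (Fin.append p.1 p.2, 1)
  fW _ p := sepMap _ n (Fin.append p.1 (Fin.append p.2.1 p.2.2), 1)
  r := r
  continuous_f0V := (continuous_sepMap _ _).comp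
    (ConstraintFeature.continuous_coord.prodMk continuous_const)
  continuous_f0W := (continuous_sepMap _ _).comp
    (VariableFeature.continuous_coord.prodMk continuous_const)
  continuous_gV _ := continuous_sepMap _ _
  continuous_gW _ := continuous_sepMap _ _
  continuous_gQ _ := continuous_sepMap _ _
  continuous_fV _ := (continuous_sepMap _ _).comp (continuous_finAppend.prodMk continuous_const)
  continuous_fW _ := (continuous_sepMap _ _).comp ((continuous_fst.finAppend
    (continuous_finAppend.comp continuous_snd)).prodMk continuous_const)
  continuous_r := hr

namespace MILCQPGraph

variable {m n : ℕ}

theorem continuous_toProd : Continuous (toProd : MILCQPGraph m n → _) := continuous_induced_dom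

theorem toProd_injective : Function.Injective (toProd : MILCQPGraph m n → _) := by
  rintro ⟨⟩ ⟨⟩ h
  simp only [toProd, Prod.mk.injEq] at h
  simp only [mk.injEq]
  exact h

instance instT2Space : T2Space (MILCQPGraph m n) :=
  haveI : T2Space (Matrix (Fin m) (Fin n) ℝ) := inferInstanceAs (T2Space (Fin m → Fin n → ℝ))
  haveI : T2Space (Matrix (Fin n) (Fin n) ℝ) := inferInstanceAs (T2Space (Fin n → Fin n → ℝ))
  T2Space.of_injective_continuous toProd_injective continuous_toProd

theorem continuous_A (i : Fin m) (j : Fin n) : Continuous fun G : MILCQPGraph m n => G.A i j :=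
  (continuous_fst.comp continuous_toProd).matrix_elem i j

theorem continuous_Q (j j' : Fin n) : Continuous fun G : MILCQPGraph m n => G.Q j j' :=
  (continuous_fst.comp (continuous_snd.comp continuous_toProd)).matrix_elem j j'

theorem continuous_vFeature (i : Fin m) :
    Continuous fun G : MILCQPGraph m n => G.vFeature i := by
  have hb := continuous_fst.comp (continuous_snd.comp (continuous_snd.comp
    (continuous_toProd (m := m) (n := n))))
  have hs := continuous_fst.comp (continuous_snd.comp (continuous_snd.comp
    (continuous_snd.comp (continuous_toProd (m := m) (n := n)))))
  exact ((continuous_apply i).comp hb).prodMk ((continuous_apply i).comp hs)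

theorem continuous_wFeature (j : Fin n) :
    Continuous fun G : MILCQPGraph m n => G.wFeature j := by
  have h := continuous_snd.comp (continuous_snd.comp (continuous_snd.comp
    (continuous_snd.comp (continuous_toProd (m := m) (n := n)))))
  have hc := continuous_fst.comp h
  have hl := continuous_fst.comp (continuous_snd.comp h)
  have hu := continuous_fst.comp (continuous_snd.comp (continuous_snd.comp h))
  have hi := continuous_snd.comp (continuous_snd.comp (continuous_snd.comp h))
  exact ((continuous_apply j).comp hc).prodMk (((continuous_apply j).comp hl).prodMk
    (((continuous_apply j).comp hu).prodMk ((continuous_apply j).comp hi)))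

/-- The node features of the separating network. -/
noncomputable def sepFeatures (G : MILCQPGraph m n) (l : ℕ) :
    (Fin m → Fin (sepDims m n l).1 → ℝ) × (Fin n → Fin (sepDims m n l).2 → ℝ) :=
  (sepGNN m n 0 (fun _ => 0) continuous_const).features G l

theorem features_sepGNN (G : MILCQPGraph m n) (L : ℕ) (r) (hr : Continuous r) (l : ℕ) :
    (sepGNN m n L r hr).features G l = G.sepFeatures l := by
  induction l with
  | zero => rfl
  | succ l ih =>
    rw [MILCQPGNN.features, ih]
    rfl

/-- The constraint features of the separating network before the last embedding. -/
noncomputable def sepArgV (G : MILCQPGraph m n) (l : ℕ) (i : Fin m) :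
    Fin ((sepDims m n l).1 + sepDim (sepDims m n l).2 n) → ℝ :=
  Fin.append ((G.sepFeatures l).1 i) (∑ j, sepMap _ n ((G.sepFeatures l).2 j, G.A i j))

/-- The variable features of the separating network before the last embedding. -/
noncomputable def sepArgW (G : MILCQPGraph m n) (l : ℕ) (j : Fin n) :
    Fin ((sepDims m n l).2 + (sepDim (sepDims m n l).1 m + sepDim (sepDims m n l).2 n)) → ℝ :=
  Fin.append ((G.sepFeatures l).2 j)
    (Fin.append (∑ i, sepMap _ m ((G.sepFeatures l).1 i, G.A i j))
      (∑ j', sepMap _ n ((G.sepFeatures l).2 j', G.Q j j')))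

theorem sepFeatures_zero_fst (G : MILCQPGraph m n) (i : Fin m) :
    (G.sepFeatures 0).1 i = sepMap 2 m ((G.vFeature i).coord, 1) := rfl

theorem sepFeatures_zero_snd (G : MILCQPGraph m n) (j : Fin n) :
    (G.sepFeatures 0).2 j = sepMap 6 n ((G.wFeature j).coord, 1) := rfl

/-- Terms of weight zero vanish, so the neighborhood, which depends discontinuously on the graph,
may be replaced by the fixed set of all nodes. -/
theorem sum_filter_sepMap {d N M : ℕ} (t : Fin M → Fin d → ℝ) (a : Fin M → ℝ) :
    ∑ j with a j ≠ 0, sepMap d N (t j, a j) = ∑ j, sepMap d N (t j, a j) := by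
  refine Finset.sum_subset (Finset.filter_subset _ _) fun j _ hj => ?_
  have : a j = 0 := by simpa using hj
  rw [this, sepMap_zero]

theorem sepFeatures_succ_fst (G : MILCQPGraph m n) (l : ℕ) (i : Fin m) :
    (G.sepFeatures (l + 1)).1 i = sepMap _ m (G.sepArgV l i, 1) := by
  rw [sepArgV, ← sum_filter_sepMap]
  rfl

theorem sepFeatures_succ_snd (G : MILCQPGraph m n) (l : ℕ) (j : Fin n) :
    (G.sepFeatures (l + 1)).2 j = sepMap _ n (G.sepArgW l j, 1) := by
  rw [sepArgW, ← sum_filter_sepMap, ← sum_filter_sepMap]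
  rfl

theorem continuous_sepFeatures (l : ℕ) :
    (∀ i, Continuous fun G : MILCQPGraph m n => (G.sepFeatures l).1 i) ∧
      ∀ j, Continuous fun G : MILCQPGraph m n => (G.sepFeatures l).2 j := by
  induction l with
  | zero =>
    constructor <;> intro k
    · simp only [sepFeatures_zero_fst]
      exact (continuous_sepMap _ _).comp
        ((ConstraintFeature.continuous_coord.comp (continuous_vFeature k)).prodMk continuous_const)
    · simp only [sepFeatures_zero_snd]
      exact (continuous_sepMap _ _).comp
        ((VariableFeature.continuous_coord.comp (continuous_wFeature k)).prodMk continuous_const)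
  | succ l ih =>
    constructor <;> intro k
    · simp only [sepFeatures_succ_fst]
      refine (continuous_sepMap _ _).comp (Continuous.prodMk ?_ continuous_const)
      exact (ih.1 k).finAppend (continuous_sum_sepMap ih.2 (continuous_A k))
    · simp only [sepFeatures_succ_snd]
      refine (continuous_sepMap _ _).comp (Continuous.prodMk ?_ continuous_const)
      exact (ih.2 k).finAppend ((continuous_sum_sepMap ih.1 fun i => continuous_A i k).finAppend
        (continuous_sum_sepMap ih.2 (continuous_Q k)))

theorem wlColor_succ_fst_eq_iff (G G' : MILCQPGraph m n) (l : ℕ) (i i' : Fin m) :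
    (G.wlColor (l + 1)).1 i = (G'.wlColor (l + 1)).1 i' ↔
      (G.wlColor l).1 i = (G'.wlColor l).1 i' ∧
        ((G.nbrVW i).val.map fun j => ((G.wlColor l).2 j, G.A i j)) =
          (G'.nbrVW i').val.map fun j => ((G'.wlColor l).2 j, G'.A i' j) :=
  Prod.mk_inj

theorem wlColor_succ_snd_eq_iff (G G' : MILCQPGraph m n) (l : ℕ) (j j' : Fin n) :
    (G.wlColor (l + 1)).2 j = (G'.wlColor (l + 1)).2 j' ↔
      (G.wlColor l).2 j = (G'.wlColor l).2 j' ∧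
        ((G.nbrWV j).val.map fun i => ((G.wlColor l).1 i, G.A i j)) =
            ((G'.nbrWV j').val.map fun i => ((G'.wlColor l).1 i, G'.A i j')) ∧
          ((G.nbrWW j).val.map fun k => ((G.wlColor l).2 k, G.Q j k)) =
            (G'.nbrWW j').val.map fun k => ((G'.wlColor l).2 k, G'.Q j' k) :=
  Prod.mk_inj.trans (and_congr_right fun _ => Prod.mk_inj)

/-- The features of the separating network are equal exactly when the WL colors are equal. -/
theorem sepFeatures_eq_iff (G G' : MILCQPGraph m n) (l : ℕ) :
    (∀ i i', (G.sepFeatures l).1 i = (G'.sepFeatures l).1 i' ↔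
        (G.wlColor l).1 i = (G'.wlColor l).1 i') ∧
      ∀ j j', (G.sepFeatures l).2 j = (G'.sepFeatures l).2 j' ↔
        (G.wlColor l).2 j = (G'.wlColor l).2 j' := by
  induction l with
  | zero =>
    refine ⟨fun i i' => ?_, fun j j' => ?_⟩
    · rw [sepFeatures_zero_fst, sepFeatures_zero_fst]
      exact ⟨fun h => ConstraintFeature.coord_injective (sepMap_one_injective i h),
        fun h => congrArg (fun v : ConstraintFeature => sepMap 2 m (v.coord, 1)) h⟩
    · rw [sepFeatures_zero_snd, sepFeatures_zero_snd]
      exact ⟨fun h => VariableFeature.coord_injective (sepMap_one_injective j h),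
        fun h => congrArg (fun w : VariableFeature => sepMap 6 n (w.coord, 1)) h⟩
  | succ l ih =>
    -- One aggregation step, for any of the three kinds of messages: if features and colors induce
    -- the same equalities, then so do the summed messages and the multisets of colors with weights.
    have key : ∀ {d N : ℕ} {γ : Type} (t t' : Fin N → Fin d → ℝ) (c c' : Fin N → γ)
        (a a' : Fin N → ℝ) (_ : ∀ j j', t j = t' j' ↔ c j = c' j'),
        ∑ j, sepMap d N (t j, a j) = ∑ j, sepMap d N (t' j, a' j) ↔
          (Finset.univ.filter fun j => a j ≠ 0).val.map (fun j => (c j, a j)) =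
            (Finset.univ.filter fun j => a' j ≠ 0).val.map fun j => (c' j, a' j) := by
      intro d N γ t t' c c' a a' h
      constructor
      · intro hs
        refine Multiset.map_eq_map_of_imp (map_eq_of_sum_sepMap_eq
          (x := fun j => (t j, a j)) (x' := fun j => (t' j, a' j)) hs) fun j j' hj => ?_
        rw [Prod.mk.injEq] at hj ⊢
        exact ⟨(h j j').1 hj.1, hj.2⟩
      · intro hs
        rw [← sum_filter_sepMap, ← sum_filter_sepMap]
        refine congrArg Multiset.sum (Multiset.map_eq_map_of_imp hs fun j j' hj => ?_)
        rw [Prod.mk.injEq] at hj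
        rw [(h j j').2 hj.1, hj.2]
    refine ⟨fun i i' => ?_, fun j j' => ?_⟩
    · rw [sepFeatures_succ_fst, sepFeatures_succ_fst]
      refine (Iff.intro (sepMap_one_injective i) fun h => by rw [h]).trans ?_
      rw [sepArgV, sepArgV, finAppend_inj, ih.1, key _ _ _ _ _ _ ih.2]
      exact (wlColor_succ_fst_eq_iff G G' l i i').symm
    · rw [sepFeatures_succ_snd, sepFeatures_succ_snd]
      refine (Iff.intro (sepMap_one_injective j) fun h => by rw [h]).trans ?_
      rw [sepArgW, sepArgW, finAppend_inj, finAppend_inj, ih.2, key _ _ _ _ _ _ ih.1,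
        key _ _ _ _ _ _ ih.2]
      exact (wlColor_succ_snd_eq_iff G G' l j j').symm

end MILCQPGraph

/-! ### Stabilization of the WL test. -/

namespace MILCQPGraph

variable {m n : ℕ}

/-- Equality of colors is inherited by earlier iterations of the WL test. -/
theorem wlColor_eq_of_le {G G' : MILCQPGraph m n} {k l : ℕ} (hkl : k ≤ l) :
    (∀ i i', (G.wlColor l).1 i = (G'.wlColor l).1 i' →
        (G.wlColor k).1 i = (G'.wlColor k).1 i') ∧
      ∀ j j', (G.wlColor l).2 j = (G'.wlColor l).2 j' →
        (G.wlColor k).2 j = (G'.wlColor k).2 j' := by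
  induction l, hkl using Nat.le_induction with
  | base => exact ⟨fun _ _ h => h, fun _ _ h => h⟩
  | succ l _ ih =>
    exact ⟨fun i i' h => ih.1 i i' ((wlColor_succ_fst_eq_iff _ _ _ _ _).1 h).1,
      fun j j' h => ih.2 j j' ((wlColor_succ_snd_eq_iff _ _ _ _ _).1 h).1⟩

open Classical in
/-- The pairs of nodes that are distinguished after `l` iterations of the WL test. -/
noncomputable def separatedPairs (G : MILCQPGraph m n) (l : ℕ) :
    Finset (Fin m × Fin m ⊕ Fin n × Fin n) :=
  Finset.univ.filter (Sum.elim (fun p => (G.wlColor l).1 p.1 ≠ (G.wlColor l).1 p.2)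
    fun p => (G.wlColor l).2 p.1 ≠ (G.wlColor l).2 p.2)

theorem separatedPairs_mono (G : MILCQPGraph m n) : Monotone G.separatedPairs := by
  intro k l hkl p hp
  simp only [separatedPairs, Finset.mem_filter, Finset.mem_univ, true_and] at hp ⊢
  rcases p with p | p
  · exact fun h => hp ((wlColor_eq_of_le hkl).1 _ _ h)
  · exact fun h => hp ((wlColor_eq_of_le hkl).2 _ _ h)

theorem separatedPairs_eq_iff (G : MILCQPGraph m n) (k l : ℕ) :
    G.separatedPairs k = G.separatedPairs l ↔
      (∀ i i', (G.wlColor k).1 i = (G.wlColor k).1 i' ↔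
        (G.wlColor l).1 i = (G.wlColor l).1 i') ∧
      ∀ j j', (G.wlColor k).2 j = (G.wlColor k).2 j' ↔
        (G.wlColor l).2 j = (G.wlColor l).2 j' := by
  simp only [separatedPairs, Finset.ext_iff, Finset.mem_filter, Finset.mem_univ, true_and,
    Sum.forall, Prod.forall, Sum.elim_inl, Sum.elim_inr, not_iff_not, ne_eq]

/-- Once an iteration of the WL test does not refine the partition, neither does the next. -/
theorem separatedPairs_stable (G : MILCQPGraph m n) (l : ℕ)
    (h : G.separatedPairs l = G.separatedPairs (l + 1)) :
    G.separatedPairs (l + 1) = G.separatedPairs (l + 2) := by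
  rw [separatedPairs_eq_iff] at h
  refine le_antisymm (G.separatedPairs_mono (Nat.le_succ _)) fun p hp => ?_
  simp only [separatedPairs, Finset.mem_filter, Finset.mem_univ, true_and] at hp ⊢
  rcases p with ⟨i, i'⟩ | ⟨j, j'⟩
  · intro hc
    simp only [Sum.elim_inl] at hp hc
    refine hp ((wlColor_succ_fst_eq_iff _ _ _ _ _).2 ⟨hc, Multiset.map_eq_map_of_imp
      ((wlColor_succ_fst_eq_iff _ _ _ _ _).1 hc).2 ?_⟩)
    intro x x' hx
    rw [Prod.mk.injEq] at hx ⊢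
    exact ⟨(h.2 _ _).1 hx.1, hx.2⟩
  · intro hc
    simp only [Sum.elim_inr] at hp hc
    have hc' := (wlColor_succ_snd_eq_iff _ _ _ _ _).1 hc
    refine hp ((wlColor_succ_snd_eq_iff _ _ _ _ _).2 ⟨hc,
      Multiset.map_eq_map_of_imp hc'.2.1 ?_, Multiset.map_eq_map_of_imp hc'.2.2 ?_⟩)
    · intro x x' hx
      rw [Prod.mk.injEq] at hx ⊢
      exact ⟨(h.1 _ _).1 hx.1, hx.2⟩
    · intro x x' hx
      rw [Prod.mk.injEq] at hx ⊢
      exact ⟨(h.2 _ _).1 hx.1, hx.2⟩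

/-- A number of iterations after which the WL test is stable. -/
def wlBound (m n : ℕ) : ℕ := m * m + n * n

/-- The separated pairs form an increasing chain in a set of `m * m + n * n` elements, and the chain
is constant from its first repetition on. -/
theorem separatedPairs_eq_bound (G : MILCQPGraph m n) {l : ℕ} (hl : wlBound m n ≤ l) :
    G.separatedPairs l = G.separatedPairs (wlBound m n) := by
  have hmono : Monotone fun l => (G.separatedPairs l).card := fun _ _ h =>
    Finset.card_le_card (G.separatedPairs_mono h)
  have heq : ∀ {k l}, k ≤ l → (G.separatedPairs k).card = (G.separatedPairs l).card →
      G.separatedPairs k = G.separatedPairs l := fun h hc =>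
    Finset.eq_of_subset_of_card_le (G.separatedPairs_mono h) hc.ge
  have := Nat.stabilises_of_monotone hmono (b := wlBound m n) (n := l)
    (fun k => (Finset.card_le_univ _).trans (by simp [wlBound]))
    (fun k hk => congrArg _ (G.separatedPairs_stable k (heq (Nat.le_succ k) hk))) hl
  exact (heq hl this.symm).symm

theorem sameClass_of_wlColor_eq (G : MILCQPGraph m n) :
    (∀ i i', (G.wlColor (wlBound m n)).1 i = (G.wlColor (wlBound m n)).1 i' →
        G.SameClassV i i') ∧
      ∀ j j', (G.wlColor (wlBound m n)).2 j = (G.wlColor (wlBound m n)).2 j' →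
        G.SameClassW j j' := by
  have key := fun l (h : wlBound m n ≤ l) =>
    (G.separatedPairs_eq_iff _ _).1 (G.separatedPairs_eq_bound h)
  constructor <;> intro i i' h l <;> rcases le_total (wlBound m n) l with hl | hl
  · exact ((key l hl).1 _ _).2 h
  · exact (wlColor_eq_of_le hl).1 _ _ h
  · exact ((key l hl).2 _ _).2 h
  · exact (wlColor_eq_of_le hl).2 _ _ h

/-! ### Colors determine feasibility of tractable graphs. -/

/-- Feasibility is transported along a relabelling of the nodes. -/
theorem IsFeasible.comp {G G' : MILCQPGraph m n} {σ : Equiv.Perm (Fin m)} {τ : Equiv.Perm (Fin n)}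
    (hA : ∀ i j, G.A i j = G'.A (σ i) (τ j)) (hv : ∀ i, G.vFeature i = G'.vFeature (σ i))
    (hw : ∀ j, G.wFeature j = G'.wFeature (τ j)) {x : Fin n → ℝ} (hx : G'.IsFeasible x) :
    G.IsFeasible (x ∘ τ) := by
  obtain ⟨h1, h2, h3, h4⟩ := hx
  simp only [vFeature, wFeature, Prod.mk.injEq] at hv hw
  refine ⟨fun i => ?_, fun j => ?_, fun j => ?_, fun j hj => ?_⟩
  · have hmul : G.A.mulVec (x ∘ τ) i = G'.A.mulVec x (σ i) := by
      simp only [Matrix.mulVec, dotProduct, hA, Function.comp_apply]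
      exact Equiv.sum_comp τ fun j => G'.A (σ i) j * x j
    rw [hmul, (hv i).1, (hv i).2]
    exact h1 _
  · rw [(hw j).2.1]
    exact h2 _
  · rw [(hw j).2.2.1]
    exact h3 _
  · rw [(hw j).2.2.2] at hj
    exact h4 _ hj

/-- If the colors of `G` and `G'` match along `σ` and `τ`, then so do the entries of `A`. -/
theorem A_eq_of_wlColor_eq {G G' : MILCQPGraph m n} (hG' : G'.MPTractable)
    {σ : Fin m → Fin m} {τ : Fin n → Fin n}
    (hσ : ∀ i, (G.wlColor (wlBound m n + 1)).1 i = (G'.wlColor (wlBound m n + 1)).1 (σ i))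
    (hτ : ∀ j, (G.wlColor (wlBound m n + 1)).2 j = (G'.wlColor (wlBound m n + 1)).2 (τ j))
    (i : Fin m) (j : Fin n) (h : G.A i j ≠ 0) : G.A i j = G'.A (σ i) (τ j) := by
  have hmem : ((G.wlColor (wlBound m n)).2 j, G.A i j) ∈
      (G.nbrVW i).val.map fun j => ((G.wlColor (wlBound m n)).2 j, G.A i j) :=
    Multiset.mem_map_of_mem _ (Finset.mem_def.1 (Finset.mem_filter.2 ⟨Finset.mem_univ j, h⟩))
  -- The extra round provides a neighbor `j'` of `σ i` in `G'` with the color of `j` and the weight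
  -- `G.A i j`. As `j'` and `τ j` then share a stable class, tractability moves the weight to `τ j`.
  rw [((wlColor_succ_fst_eq_iff _ _ _ _ _).1 (hσ i)).2] at hmem
  obtain ⟨j', _, hj'⟩ := Multiset.mem_map.1 hmem
  rw [Prod.mk.injEq] at hj'
  rw [← hj'.2]
  refine hG'.1 _ _ _ _ (fun _ => rfl) (G'.sameClass_of_wlColor_eq.2 _ _ ?_)
  rw [hj'.1]
  exact ((wlColor_succ_snd_eq_iff _ _ _ _ _).1 (hτ j)).1

/-- Message-passing-tractable graphs whose nodes have the same colors are isomorphic, so their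
problems are both feasible or both infeasible. -/
theorem exists_isFeasible_of_wlColor_eq {G G' : MILCQPGraph m n} (hG : G.MPTractable)
    (hG' : G'.MPTractable) {σ : Equiv.Perm (Fin m)} {τ : Equiv.Perm (Fin n)}
    (hσ : ∀ i, (G.wlColor (wlBound m n + 1)).1 i = (G'.wlColor (wlBound m n + 1)).1 (σ i))
    (hτ : ∀ j, (G.wlColor (wlBound m n + 1)).2 j = (G'.wlColor (wlBound m n + 1)).2 (τ j))
    (h : ∃ x, G'.IsFeasible x) : ∃ x, G.IsFeasible x := by
  obtain ⟨x, hx⟩ := h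
  refine ⟨_, IsFeasible.comp (σ := σ) (τ := τ) (fun i j => ?_)
    (fun i => (wlColor_eq_of_le (Nat.zero_le _)).1 _ _ (hσ i))
    (fun j => (wlColor_eq_of_le (Nat.zero_le _)).2 _ _ (hτ j)) hx⟩
  by_cases hij : G.A i j = 0
  · by_cases hij' : G'.A (σ i) (τ j) = 0
    · rw [hij, hij']
    -- A zero entry leaves no trace in the colors, so a nonzero entry of `G'` is carried back to `G`
    -- by the inverse permutations.
    · have := A_eq_of_wlColor_eq (G := G') (G' := G) hG (σ := σ.symm) (τ := τ.symm)
        (fun i => by rw [hσ, Equiv.apply_symm_apply]) (fun j => by rw [hτ, Equiv.apply_symm_apply])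
        _ _ hij'
      simpa using this.symm
  · exact A_eq_of_wlColor_eq hG' hσ hτ i j hij

/-! ### Measurability of tractability and of feasibility. -/

/-- Equality of colors is equality of the continuous features of the separating network. -/
theorem isClosed_sameClassV (i i' : Fin m) :
    IsClosed {G : MILCQPGraph m n | G.SameClassV i i'} := by
  have : {G : MILCQPGraph m n | G.SameClassV i i'} =
      ⋂ l, {G | (G.sepFeatures l).1 i = (G.sepFeatures l).1 i'} := by
    ext G
    simp only [SameClassV, Set.mem_ofPred_eq, Set.mem_iInter, (sepFeatures_eq_iff G G _).1]
  rw [this]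
  exact isClosed_iInter fun l =>
    isClosed_eq ((continuous_sepFeatures l).1 i) ((continuous_sepFeatures l).1 i')

theorem isClosed_sameClassW (j j' : Fin n) :
    IsClosed {G : MILCQPGraph m n | G.SameClassW j j'} := by
  have : {G : MILCQPGraph m n | G.SameClassW j j'} =
      ⋂ l, {G | (G.sepFeatures l).2 j = (G.sepFeatures l).2 j'} := by
    ext G
    simp only [SameClassW, Set.mem_ofPred_eq, Set.mem_iInter, (sepFeatures_eq_iff G G _).2]
  rw [this]
  exact isClosed_iInter fun l =>
    isClosed_eq ((continuous_sepFeatures l).2 j) ((continuous_sepFeatures l).2 j')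

theorem measurableSet_mpTractable : MeasurableSet {G : MILCQPGraph m n | G.MPTractable} := by
  have hV := fun i i' => (isClosed_sameClassV (m := m) (n := n) i i').measurableSet
  have hW := fun j j' => (isClosed_sameClassW (m := m) (n := n) j j').measurableSet
  have hA := fun i i' j j' =>
    (isClosed_eq (continuous_A (m := m) (n := n) i j) (continuous_A i' j')).measurableSet
  have hQ := fun j₁ j₁' j₂ j₂' =>
    (isClosed_eq (continuous_Q (m := m) (n := n) j₁ j₂) (continuous_Q j₁' j₂')).measurableSet
  simp only [MPTractable, Set.ofPred_and, Set.ofPred_forall]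
  refine MeasurableSet.inter ?_ ?_
  · refine .iInter fun i => .iInter fun i' => .iInter fun j => .iInter fun j' => ?_
    exact (hV i i').himp ((hW j j').himp (hA i i' j j'))
  · refine .iInter fun i => .iInter fun i' => .iInter fun j => .iInter fun j' => ?_
    exact (hW i i').himp ((hW j j').himp (hQ i i' j j'))

theorem isClosed_senseHolds : IsClosed {p : ConstraintFeature × ℝ | p.1.2.Holds p.2 p.1.1} := by
  have : {p : ConstraintFeature × ℝ | p.1.2.Holds p.2 p.1.1} =
      ({p | p.1.2 = .le} ∩ {p | p.2 ≤ p.1.1}) ∪ ({p | p.1.2 = .eq} ∩ {p | p.2 = p.1.1}) ∪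
        ({p | p.1.2 = .ge} ∩ {p | p.1.1 ≤ p.2}) := by
    ext ⟨⟨β, s⟩, y⟩
    cases s <;> simp [ConstraintSense.Holds]
  rw [this]
  have hs : Continuous fun p : ConstraintFeature × ℝ => p.1.2 := by fun_prop
  have hy : Continuous fun p : ConstraintFeature × ℝ => p.1.1 := by fun_prop
  exact (((isClosed_eq hs continuous_const).inter (isClosed_le continuous_snd hy)).union
    ((isClosed_eq hs continuous_const).inter (isClosed_eq continuous_snd hy))).union
    ((isClosed_eq hs continuous_const).inter (isClosed_le hy continuous_snd))

theorem isClosed_lowerBoundHolds :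
    IsClosed {p : LowerBound × ℝ | LowerBound.Holds p.1 p.2} := by
  have : {p : LowerBound × ℝ | LowerBound.Holds p.1 p.2} =
      {p | boundFlag p.1 = 1} ∪ ({p | boundFlag p.1 = 0} ∩ {p | boundValue p.1 ≤ p.2}) := by
    ext ⟨a | a, y⟩ <;> simp [LowerBound.Holds, boundFlag, boundValue]
  rw [this]
  have hf := continuous_boundFlag.comp (continuous_fst (X := LowerBound) (Y := ℝ))
  exact (isClosed_eq hf continuous_const).union ((isClosed_eq hf continuous_const).inter
    (isClosed_le (continuous_boundValue.comp continuous_fst) continuous_snd))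

theorem isClosed_upperBoundHolds :
    IsClosed {p : UpperBound × ℝ | UpperBound.Holds p.1 p.2} := by
  have : {p : UpperBound × ℝ | UpperBound.Holds p.1 p.2} =
      {p | boundFlag p.1 = 1} ∪ ({p | boundFlag p.1 = 0} ∩ {p | p.2 ≤ boundValue p.1}) := by
    ext ⟨a | a, y⟩ <;> simp [UpperBound.Holds, boundFlag, boundValue]
  rw [this]
  have hf := continuous_boundFlag.comp (continuous_fst (X := UpperBound) (Y := ℝ))
  exact (isClosed_eq hf continuous_const).union ((isClosed_eq hf continuous_const).inter
    (isClosed_le continuous_snd (continuous_boundValue.comp continuous_fst)))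

theorem isClosed_integrality :
    IsClosed {p : Bool × ℝ | p.1 = true → ∃ z : ℤ, p.2 = z} := by
  have : {p : Bool × ℝ | p.1 = true → ∃ z : ℤ, p.2 = z} =
      {p | p.1 = false} ∪ Prod.snd ⁻¹' Set.range ((↑) : ℤ → ℝ) := by
    ext ⟨a, y⟩
    cases a <;> simp [Set.mem_range, @eq_comm ℝ y]
  rw [this]
  exact (isClosed_eq continuous_fst continuous_const).union
    (Int.isClosedEmbedding_coe_real.isClosed_range.preimage continuous_snd)

theorem isClosed_isFeasible :
    IsClosed {p : MILCQPGraph m n × (Fin n → ℝ) | p.1.IsFeasible p.2} := by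
  have hx : ∀ j, Continuous fun p : MILCQPGraph m n × (Fin n → ℝ) => p.2 j := fun j => by fun_prop
  have hw : ∀ j, Continuous fun p : MILCQPGraph m n × (Fin n → ℝ) => p.1.wFeature j := fun j =>
    (continuous_wFeature j).comp continuous_fst
  have hl := fun j => continuous_fst.comp (continuous_snd.comp (hw j))
  have hu := fun j => continuous_fst.comp (continuous_snd.comp (continuous_snd.comp (hw j)))
  have hi := fun j => continuous_snd.comp (continuous_snd.comp (continuous_snd.comp (hw j)))
  have hmul : ∀ i, Continuous fun p : MILCQPGraph m n × (Fin n → ℝ) => p.1.A.mulVec p.2 i :=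
    fun i => continuous_finsetSum Finset.univ fun j _ =>
      ((continuous_A i j).comp' continuous_fst).mul (hx j)
  simp only [IsFeasible, Set.ofPred_and, Set.ofPred_forall]
  refine .inter (isClosed_iInter fun i => ?_) (.inter (isClosed_iInter fun j => ?_)
    (.inter (isClosed_iInter fun j => ?_) (isClosed_iInter fun j => ?_)))
  · exact isClosed_senseHolds.preimage
      (((continuous_vFeature i).comp continuous_fst).prodMk (hmul i))
  · exact isClosed_lowerBoundHolds.preimage ((hl j).prodMk (hx j))
  · exact isClosed_upperBoundHolds.preimage ((hu j).prodMk (hx j))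
  · exact isClosed_integrality.preimage ((hi j).prodMk (hx j))

/-- Projection along a compact ball is a closed map, so the graphs with a feasible point of norm at
most `R` form a closed set; the union over natural `R` is countable. -/
theorem measurableSet_exists_isFeasible :
    MeasurableSet {G : MILCQPGraph m n | ∃ x, G.IsFeasible x} := by
  have : {G : MILCQPGraph m n | ∃ x, G.IsFeasible x} = ⋃ R : ℕ, Prod.fst ''
      {p : MILCQPGraph m n × Metric.closedBall (0 : Fin n → ℝ) R | p.1.IsFeasible p.2} := by
    ext G
    simp only [Set.mem_ofPred_eq, Set.mem_iUnion, Set.mem_image, Prod.exists, exists_and_right,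
      exists_eq_right]
    constructor
    · rintro ⟨x, hx⟩
      obtain ⟨R, hR⟩ := exists_nat_ge ‖x‖
      exact ⟨R, ⟨x, by simpa using hR⟩, hx⟩
    · rintro ⟨R, x, hx⟩
      exact ⟨x, hx⟩
  rw [this]
  refine MeasurableSet.iUnion fun R => IsClosed.measurableSet ?_
  have : CompactSpace (Metric.closedBall (0 : Fin n → ℝ) R) :=
    isCompact_iff_compactSpace.1 (isCompact_closedBall _ _)
  exact isClosedMap_fst_of_compactSpace _ (isClosed_isFeasible.preimage
    (continuous_fst.prodMk (continuous_subtype_val.comp continuous_snd)))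

/-! ### The readout and the main theorem. -/

/-- The sums of the node features of the separating network. -/
noncomputable def sepSum (G : MILCQPGraph m n) (L : ℕ) :
    (Fin (sepDims m n L).1 → ℝ) × (Fin (sepDims m n L).2 → ℝ) :=
  (∑ i, (G.sepFeatures L).1 i, ∑ j, (G.sepFeatures L).2 j)

theorem continuous_sepSum (L : ℕ) : Continuous fun G : MILCQPGraph m n => G.sepSum L :=
  (continuous_finsetSum _ fun i _ => (continuous_sepFeatures L).1 i).prodMk
    (continuous_finsetSum _ fun j _ => (continuous_sepFeatures L).2 j)

theorem eval_sepGNN (G : MILCQPGraph m n) (L : ℕ) (r) (hr : Continuous r) :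
    (sepGNN m n L r hr).eval G = r (G.sepSum L) := by
  change r _ = r _
  rw [features_sepGNN]
  rfl

/-- Equal sums of features force equal multisets of colors. -/
theorem exists_perm_of_sepSum_eq {G G' : MILCQPGraph m n} {l : ℕ}
    (h : G.sepSum (l + 1) = G'.sepSum (l + 1)) :
    ∃ (σ : Equiv.Perm (Fin m)) (τ : Equiv.Perm (Fin n)),
      (∀ i, (G.wlColor (l + 1)).1 i = (G'.wlColor (l + 1)).1 (σ i)) ∧
        ∀ j, (G.wlColor (l + 1)).2 j = (G'.wlColor (l + 1)).2 (τ j) := by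
  rw [sepSum, sepSum, Prod.mk.injEq] at h
  simp only [sepFeatures_succ_fst, sepFeatures_succ_snd] at h
  obtain ⟨σ, hσ⟩ := exists_perm_of_map_univ_eq (map_eq_of_sum_sepMap_one_eq h.1)
  obtain ⟨τ, hτ⟩ := exists_perm_of_map_univ_eq (map_eq_of_sum_sepMap_one_eq h.2)
  refine ⟨σ, τ, fun i => ?_, fun j => ?_⟩
  · rw [← (sepFeatures_eq_iff G G' (l + 1)).1, sepFeatures_succ_fst, sepFeatures_succ_fst, hσ]
  · rw [← (sepFeatures_eq_iff G G' (l + 1)).2, sepFeatures_succ_snd, sepFeatures_succ_snd, hτ]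

end MILCQPGraph

theorem theorem4p4 (m n : ℕ) (P : Measure (MILCQPGraph m n)) [IsProbabilityMeasure P]
    [P.Regular] (hP : P {G | G.MPTractable} = 1) (ε : ℝ) (hε : 0 < ε) :
    ∃ F : MILCQPGNN, P {G | F.classify G ≠ G.feas} < ENNReal.ofReal ε := by
  let T := {G : MILCQPGraph m n | G.MPTractable}
  let S := {G : MILCQPGraph m n | ∃ x, G.IsFeasible x}
  have hT : MeasurableSet T := MILCQPGraph.measurableSet_mpTractable
  have hS : MeasurableSet S := MILCQPGraph.measurableSet_exists_isFeasible
  have hε' : ENNReal.ofReal (ε / 2) ≠ 0 := by simpa using hε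
  obtain ⟨K₁, hK₁, hc₁, hm₁⟩ := (hT.inter hS).exists_isCompact_sdiff_lt (measure_ne_top P _) hε'
  obtain ⟨K₀, hK₀, hc₀, hm₀⟩ := (hT.diff hS).exists_isCompact_sdiff_lt (measure_ne_top P _) hε'
  let L := MILCQPGraph.wlBound m n + 1
  have hcont := MILCQPGraph.continuous_sepSum (m := m) (n := n) L
  -- A common value would match the colors of an infeasible and a feasible tractable graph, and
  -- feasibility would transfer.
  have hdisj : Disjoint ((fun G => G.sepSum L) '' K₀) ((fun G => G.sepSum L) '' K₁) := by
    rw [Set.disjoint_left]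
    rintro _ ⟨G, hG, rfl⟩ ⟨G', hG', h⟩
    obtain ⟨σ, τ, hσ, hτ⟩ := MILCQPGraph.exists_perm_of_sepSum_eq h.symm
    exact (hK₀ hG).2 (MILCQPGraph.exists_isFeasible_of_wlColor_eq (hK₀ hG).1 (hK₁ hG').1 hσ hτ
      (hK₁ hG').2)
  obtain ⟨r, hr₀, hr₁, -⟩ := exists_continuous_zero_one_of_isClosed (hc₀.image hcont).isClosed
    (hc₁.image hcont).isClosed hdisj
  refine ⟨sepGNN m n L r r.continuous, ?_⟩
  -- On `K₁` and `K₀` the readout is exactly 1 and 0, so errors occur only on the null set `Tᶜ` and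
  -- on the two small remainders.
  have hsub : {G : MILCQPGraph m n | (sepGNN m n L r r.continuous).classify G ≠ G.feas} ⊆
      Tᶜ ∪ ((T ∩ S) \ K₁ ∪ (T \ S) \ K₀) := by
    intro G hG
    by_contra hcon
    simp only [Set.mem_union, Set.mem_compl_iff, not_or, not_not, Set.mem_sdiff, not_and] at hcon
    obtain ⟨hGT, hG₁, hG₀⟩ := hcon
    refine hG ?_
    rw [MILCQPGNN.classify, MILCQPGraph.eval_sepGNN, MILCQPGraph.feas]
    by_cases hGS : G ∈ S
    · have : r (G.sepSum L) = 1 := hr₁ ⟨G, hG₁ ⟨hGT, hGS⟩, rfl⟩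
      rw [this, if_pos (by norm_num), if_pos (show ∃ x, G.IsFeasible x from hGS)]
    · have : r (G.sepSum L) = 0 := hr₀ ⟨G, hG₀ ⟨hGT, hGS⟩, rfl⟩
      rw [this, if_neg (by norm_num), if_neg (show ¬∃ x, G.IsFeasible x from hGS)]
  calc P _ ≤ P (Tᶜ ∪ ((T ∩ S) \ K₁ ∪ (T \ S) \ K₀)) := measure_mono hsub
    _ ≤ P Tᶜ + (P ((T ∩ S) \ K₁) + P ((T \ S) \ K₀)) :=
      (measure_union_le _ _).trans (by gcongr; exact measure_union_le _ _)
    _ = P ((T ∩ S) \ K₁) + P ((T \ S) \ K₀) := by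
      rw [(prob_compl_eq_zero_iff hT).2 hP, zero_add]
    _ < ENNReal.ofReal (ε / 2) + ENNReal.ofReal (ε / 2) := ENNReal.add_lt_add hm₁ hm₀
    _ = ENNReal.ofReal ε := by
      rw [← ENNReal.ofReal_add (by positivity) (by positivity), add_halves]
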